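/- Let $(\mathbb M,d)$ be a compact metric space. For a set $X$ with a metric $\rho$, $\varepsilon>0$ and $s\ge 0$ put $$\mathrm H^s_\varepsilon(X,\rho)=\inf\Big\{\sum_{n=1}^\infty(\operatorname{diam}_\rho E_n)^s:\ X=\bigcup_{n=1}^\infty E_n,\ \operatorname{diam}_\rho E_n<\varepsilon\text{ for all }n\Big\}$$ (with $0^0=1$ and $(\operatorname{diam}\emptyset)^s=0$) and $\dim_{\mathrm H}(X,\rho,\varepsilon)=\sup\{s\ge 0:\mathrm H^s_\varepsilon(X,\rho)\ge 1\}\in[0,\infty]$ (with $\sup\emptyset=0$). For $f:X\to X$ and $n\ge1$ let $\rho_n(x,y)=\max_{0\le k<n}\rho(f^k(x),f^k(y))$. The lower and upper mean Hausdorff dimensions of $(X,\rho,f)$ are $$\underline{\mathrm{mdim}}_{\mathrm H}(X,\rho,f)=\lim_{\varepsilon\to0}\liminf_{n\to\infty}\tfrac1n\dim_{\mathrm H}(X,\rho_n,\varepsilon),\qquad \overline{\mathrm{mdim}}_{\mathrm H}(X,\rho,f)=\lim_{\varepsilon\to0}\limsup_{n\to\infty}\tfrac1n\dim_{\mathrm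 H}(X,\rho_n,\varepsilon).$$ Let $\mathbb K=\mathbb N=\{1,2,\dots\}$ or $\mathbb K=\mathbb Z$, let $\mathbb M^{\mathbb K}$ carry the metric $\mathbf d(\bar x,\bar y)=\sum_{j\in\mathbb K}2^{-|j|}d(x_j,y_j)$, and let $\sigma:\mathbb M^{\mathbb K}\to\mathbb M^{\mathbb K}$, $(\sigma\bar x)_j=x_{j+1}$, be the left shift. Let $\dim_{\mathrm H}(\mathbb M,d)$ denote the Hausdorff dimension and $\underline{\dim}_{\mathrm B}(\mathbb M,d)=\liminf_{\varepsilon\to0}\frac{\log N(\varepsilon)}{|\log\varepsilon|}$ the lower box dimension, where $N(\varepsilon)$ is the least number of closed $\varepsilon$-balls covering $\mathbb M$. Suppose that $\dim_{\mathrm H}(\mathbb M,d)=\underline{\dim}_{\mathrm B}(\mathbb M,d)$ (the common value may be $\infty$). Then: 1. for both choices of $\mathbb K$, $\ \underline{\mathrm{mdim}}_{\mathrm H}(\mathbb M^{\mathbb K},\mathbf d,\sigma)=\overline{\mathrm{mdim}}_{\mathrm H}(\mathbb M^{\mathbb K},\mathbf d,\sigma)=\dim_{\mathrm H}(\mathbb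 M,d)$; 2. for every continuous map $f:\mathbb M\to\mathbb M$, $\ \underline{\mathrm{mdim}}_{\mathrm H}(\mathbb M,d,f)\le\overline{\mathrm{mdim}}_{\mathrm H}(\mathbb M,d,f)\le\dim_{\mathrm H}(\mathbb M,d)$. -/

import Mathlib

open Set Filter Topology
open scoped NNReal ENNReal

noncomputable section

namespace MeanHausdorff

/-- The diameter of `E` with respect to a distance function `ρ`, with values in `[0, ∞]`
(the empty set has diameter `0`). -/
def diam {X : Type*} (ρ : X → X → ℝ) (E : Set X) : ℝ≥0∞ :=
  ⨆ x ∈ E, ⨆ y ∈ E, ENNReal.ofReal (ρ x y)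

/-- `H_ε^s(X, ρ)`: the infimum of `∑ (diam E_n)^s` over the countable covers of `X` by sets of
diameter `< ε`. Conventions: `0 ^ 0 = 1`, and an empty `E_n` contributes `0`. -/
def hausdorffContent {X : Type*} (ρ : X → X → ℝ) (ε s : ℝ≥0) : ℝ≥0∞ :=
  ⨅ (E : ℕ → Set X) (_ : ⋃ n, E n = univ) (_ : ∀ n, diam ρ (E n) < ε),
    ∑' n, ⨆ _ : (E n).Nonempty, diam ρ (E n) ^ (s : ℝ)

/-- `dim_H(X, ρ, ε) = sup {s ≥ 0 : H_ε^s(X, ρ) ≥ 1}`, an element of `[0, ∞]`. -/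
def dimScale {X : Type*} (ρ : X → X → ℝ) (ε : ℝ≥0) : ℝ≥0∞ :=
  ⨆ (s : ℝ≥0) (_ : 1 ≤ hausdorffContent ρ ε s), (s : ℝ≥0∞)

/-- The dynamical distance `ρ_n(x, y) = max_{0 ≤ k < n} ρ(f^k x, f^k y)`. -/
def dynDist {X : Type*} (ρ : X → X → ℝ) (f : X → X) (n : ℕ) (x y : X) : ℝ :=
  ⨆ k : Fin n, ρ (f^[k] x) (f^[k] y)

/-- `limsup_n (1/n) dim_H(X, ρ_n, ε)`. -/
def upperRate {X : Type*} (ρ : X → X → ℝ) (f : X → X) (ε : ℝ≥0) : ℝ≥0∞ :=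
  limsup (fun n : ℕ => dimScale (dynDist ρ f n) ε / (n : ℝ≥0∞)) atTop

/-- `liminf_n (1/n) dim_H(X, ρ_n, ε)`. -/
def lowerRate {X : Type*} (ρ : X → X → ℝ) (f : X → X) (ε : ℝ≥0) : ℝ≥0∞ :=
  liminf (fun n : ℕ => dimScale (dynDist ρ f n) ε / (n : ℝ≥0∞)) atTop

/-- The upper mean Hausdorff dimension of `(X, ρ, f)`: the limit of `upperRate` as `ε → 0⁺`
(it always exists, see `tendsto_upperRate`). -/
def upperMdimH {X : Type*} (ρ : X → X → ℝ) (f : X → X) : ℝ≥0∞ :=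
  limUnder (𝓝[>] (0 : ℝ≥0)) (upperRate ρ f)

/-- The lower mean Hausdorff dimension of `(X, ρ, f)`: the limit of `lowerRate` as `ε → 0⁺`
(it always exists, see `tendsto_lowerRate`). -/
def lowerMdimH {X : Type*} (ρ : X → X → ℝ) (f : X → X) : ℝ≥0∞ :=
  limUnder (𝓝[>] (0 : ℝ≥0)) (lowerRate ρ f)

/-- The lower box dimension `liminf_{ε → 0⁺} log N(ε) / |log ε|`, where `N(ε)` is the least
number of closed `ε`-balls that cover `M`. -/
def lowerBoxDim (M : Type*) [MetricSpace M] : ℝ≥0∞ :=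
  liminf (fun ε : ℝ≥0 => ENNReal.ofReal
    (Real.log ((Metric.coveringNumber ε (univ : Set M)).toNat : ℝ) / |Real.log (ε : ℝ)|))
    (𝓝[>] (0 : ℝ≥0))

/-- The distance `∑_{j ∈ K} 2^{-|j|} d(x_j, y_j)` on sequences `K → M`, where `absIdx j` is the
absolute value `|j|` of the index `j`. -/
def prodDist {K M : Type*} [MetricSpace M] (absIdx : K → ℕ) (x y : K → M) : ℝ :=
  ∑' j, 1 / 2 ^ absIdx j * dist (x j) (y j)

/-- The product distance on `M^ℕ`, `ℕ = {1, 2, 3, …}`. -/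
def prodDistNat {M : Type*} [MetricSpace M] : (ℕ+ → M) → (ℕ+ → M) → ℝ :=
  prodDist (fun j : ℕ+ => (j : ℕ))

/-- The product distance on `M^ℤ`. -/
def prodDistInt {M : Type*} [MetricSpace M] : (ℤ → M) → (ℤ → M) → ℝ :=
  prodDist Int.natAbs

/-- The left shift `(σ x)_j = x_{j+1}`. -/
def shift {K M : Type*} [Add K] [One K] (x : K → M) : K → M := fun j => x (j + 1)

/-! The limits and the series in the definitions above exist. -/

theorem hausdorffContent_anti {X : Type*} (ρ : X → X → ℝ) (s : ℝ≥0) {ε δ : ℝ≥0} (h : ε ≤ δ) :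
    hausdorffContent ρ δ s ≤ hausdorffContent ρ ε s := by
  unfold hausdorffContent
  refine le_iInf fun E => le_iInf fun hE => le_iInf fun hd => ?_
  exact iInf_le_of_le E (iInf_le_of_le hE (iInf_le_of_le
    (fun n => (hd n).trans_le (by exact_mod_cast h)) le_rfl))

theorem dimScale_antitone {X : Type*} (ρ : X → X → ℝ) : Antitone (dimScale ρ) := by
  intro ε δ h
  refine iSup_le fun s => iSup_le fun hs => ?_
  exact le_iSup₂_of_le s (hs.trans (hausdorffContent_anti ρ s h)) le_rfl

theorem upperRate_antitone {X : Type*} (ρ : X → X → ℝ) (f : X → X) :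
    Antitone (upperRate ρ f) := by
  intro ε δ h
  exact limsup_le_limsup (Eventually.of_forall fun n =>
    ENNReal.div_le_div_right (dimScale_antitone _ h) _)

theorem lowerRate_antitone {X : Type*} (ρ : X → X → ℝ) (f : X → X) :
    Antitone (lowerRate ρ f) := by
  intro ε δ h
  exact liminf_le_liminf (Eventually.of_forall fun n =>
    ENNReal.div_le_div_right (dimScale_antitone _ h) _)

theorem tendsto_upperRate {X : Type*} (ρ : X → X → ℝ) (f : X → X) :
    Tendsto (upperRate ρ f) (𝓝[>] (0 : ℝ≥0)) (𝓝 (upperMdimH ρ f)) :=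
  tendsto_nhds_limUnder ⟨_, (upperRate_antitone ρ f).tendsto_nhdsGT 0⟩

theorem tendsto_lowerRate {X : Type*} (ρ : X → X → ℝ) (f : X → X) :
    Tendsto (lowerRate ρ f) (𝓝[>] (0 : ℝ≥0)) (𝓝 (lowerMdimH ρ f)) :=
  tendsto_nhds_limUnder ⟨_, (lowerRate_antitone ρ f).tendsto_nhdsGT 0⟩

theorem summable_of_weights {K M : Type*} [MetricSpace M] [CompactSpace M] (absIdx : K → ℕ)
    (hw : Summable fun j => (1 : ℝ) / 2 ^ absIdx j) (x y : K → M) :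
    Summable fun j => (1 : ℝ) / 2 ^ absIdx j * dist (x j) (y j) := by
  refine Summable.of_nonneg_of_le (fun j => by positivity) (fun j => ?_)
    (hw.mul_right (Metric.diam (univ : Set M)))
  exact mul_le_mul_of_nonneg_left
    (Metric.dist_le_diam_of_mem isCompact_univ.isBounded (mem_univ _) (mem_univ _)) (by positivity)

theorem summable_prodDistNat {M : Type*} [MetricSpace M] [CompactSpace M] (x y : ℕ+ → M) :
    Summable fun j : ℕ+ => (1 : ℝ) / 2 ^ (j : ℕ) * dist (x j) (y j) := by
  refine summable_of_weights (fun j : ℕ+ => (j : ℕ)) ?_ x y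
  have h : Summable fun j : ℕ => (1 : ℝ) / 2 ^ j := by
    simpa using summable_geometric_two
  exact h.comp_injective PNat.coe_injective

theorem summable_prodDistInt {M : Type*} [MetricSpace M] [CompactSpace M] (x y : ℤ → M) :
    Summable fun j : ℤ => (1 : ℝ) / 2 ^ j.natAbs * dist (x j) (y j) := by
  refine summable_of_weights Int.natAbs ?_ x y
  have h : Summable fun j : ℕ => (1 : ℝ) / 2 ^ j := by
    simpa using summable_geometric_two
  exact Summable.of_nat_of_neg (by simpa using h) (by simpa using h)

end MeanHausdorff

end

namespace MeanHausdorff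

/-! The chain is `dimH` ≤ lower mean dimension ≤ upper mean dimension ≤ lower box dimension, the
outer inequalities holding without the dimension hypothesis, which then closes the chain; for a
general map only the upper bound remains.

Upper bound (`upperMdimH_le_lowerBoxDim`): `n + m` maps into `M`, with `m` independent of `n`,
control the `n`-th dynamical distance up to a constant. Products of `ε`-balls give `N(ε) ^ (n + m)`
sets of diameter at most `C * ε`. At a fixed scale `δ` every `ε` with `C * ε < δ` is admissible, so
the bound survives a liminf over `ε`; this is why the lower box dimension suffices.

Lower bound (`dimH_le_lowerMdimH`): Hausdorff content lower bounds must pass to `M^n` at a scale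
independent of `n`. Unweighted covers do not support induction on `n`, since slicing a cover of a
product produces weights. So weighted covers are used: for `s < dimH` their mass is at least one
below some scale (`one_le_weighted_sum_of_lt_dimH`), a property that tensorizes at that same scale
(`one_le_weighted_sum_pi`). A cover of the sequence space projects coordinatewise to boxes covering
`M^n`. -/

/-! ### Weighted covers and Hausdorff dimension -/

theorem pow_rpow_comm (x : ℝ≥0∞) (n : ℕ) (u : ℝ) : (x ^ n) ^ u = (x ^ u) ^ n := by
  rw [← ENNReal.rpow_natCast, ← ENNReal.rpow_natCast, ← ENNReal.rpow_mul, ← ENNReal.rpow_mul,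
    mul_comm]

theorem coveringNumber_univ_ne_top {M : Type*} [MetricSpace M] [CompactSpace M] {ε : ℝ≥0}
    (hε : 0 < ε) : Metric.coveringNumber ε (univ : Set M) ≠ ⊤ := by
  obtain ⟨t, ht, hfin, hcov⟩ := (isCompact_univ (X := M)).finite_cover_balls
    (e := (ε : ℝ)) (by exact_mod_cast hε)
  refine ne_top_of_le_ne_top (Set.encard_ne_top_iff.2 hfin)
    (Metric.IsCover.coveringNumber_le_encard ht ?_)
  intro x hx
  obtain ⟨y, hy, hxy⟩ := mem_iUnion₂.1 (hcov hx)
  refine ⟨y, hy, ?_⟩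
  rw [Metric.mem_ball] at hxy
  simp only [mem_ofPred_eq]
  rw [edist_nndist]
  exact_mod_cast hxy.le

theorem packingNumber_ne_top {M : Type*} [MetricSpace M] [CompactSpace M] {ε : ℝ≥0}
    (hε : 0 < ε) (A : Set M) : Metric.packingNumber ε A ≠ ⊤ := by
  have h1 : Metric.packingNumber ε A ≤ Metric.packingNumber ε (univ : Set M) :=
    iSup_le fun C => iSup_le fun _ => iSup_le fun hC =>
      hC.encard_le_packingNumber (subset_univ C)
  have h2 := Metric.packingNumber_two_mul_le_externalCoveringNumber (ε / 2) (univ : Set M)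
  rw [mul_div_cancel₀ _ (two_ne_zero)] at h2
  exact ne_top_of_le_ne_top (coveringNumber_univ_ne_top (half_pos hε))
    (h1.trans (h2.trans (Metric.externalCoveringNumber_le_coveringNumber _ _)))

/-- A weighted countable cover by sets of dyadic size can be replaced by a genuine cover by
finitely many balls at each scale, at the price of a summable factor. -/
theorem exists_cover_of_weighted_cover {M : Type*} [MetricSpace M] [CompactSpace M]
    (a : ℝ≥0∞) {q : ℝ≥0∞} (E : ℕ → Set M) (c : ℕ → ℝ≥0∞) (k : ℕ → ℕ) (k₀ : ℕ)
    (hE : ∀ i, ∀ x ∈ E i, ∀ y ∈ E i, edist x y ≤ 2⁻¹ ^ k i) (hk : ∀ i, k₀ ≤ k i)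
    (hq : ∑' j, q ^ (j + k₀) < 1) (hc : ∀ x, 1 ≤ ∑' i, (E i).indicator (fun _ => c i) x) :
    ∃ P : ℕ → Set M, (∀ j, (P j).Finite) ∧ (∀ j < k₀, P j = ∅) ∧
      (∀ x, ∃ j, ∃ p ∈ P j, edist x p ≤ 2⁻¹ ^ j) ∧
      ∑' j, ∑' _ : P j, (a * q) ^ j ≤ ∑' i, c i * a ^ k i := by
  classical
  set S : ℕ → M → ℝ≥0∞ :=
    fun j x => ∑' i, if k i = j then (E i).indicator (fun _ => c i) x else 0 with hS
  -- Points whose level-`j` weight exceeds `q ^ j`. These thresholds sum to less than one over `j ≥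
  -- k₀`, so every point exceeds one of them.
  set A : ℕ → Set M := fun j => {x | q ^ j < S j x} with hA
  set r : ℕ → ℝ≥0 := fun j => 2⁻¹ ^ j with hr
  have hr0 : ∀ j, 0 < r j := fun j => by positivity
  have hrc : ∀ j, ((r j : ℝ≥0) : ℝ≥0∞) = 2⁻¹ ^ j := fun j => by
    simp [hr, ENNReal.coe_inv, ENNReal.inv_pow]
  have hpack : ∀ j, Metric.packingNumber (r j) (A j) ≠ ⊤ := fun j =>
    packingNumber_ne_top (hr0 j) _
  set P : ℕ → Set M := fun j => Metric.maximalSeparatedSet (r j) (A j) with hP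
  have hPA : ∀ j, P j ⊆ A j := fun j => Metric.maximalSeparatedSet_subset
  refine ⟨P, fun j => ?_, fun j hj => ?_, fun x => ?_, ?_⟩
  · rw [← Set.encard_ne_top_iff, hP, Metric.encard_maximalSeparatedSet (hpack j)]
    exact hpack j
  · refine subset_empty_iff.1 ((hPA j).trans fun x hx => ?_)
    have : S j x = 0 := by
      simp only [hS, ENNReal.tsum_eq_zero]
      intro i
      rw [if_neg]
      have := hk i
      omega
    simp [hA, this] at hx
  · obtain ⟨j, hj⟩ : ∃ j, x ∈ A j := by
      by_contra! hcon
      have h1 : ∑' i, (E i).indicator (fun _ => c i) x = ∑' j, S (j + k₀) x := by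
        simp only [hS]
        rw [ENNReal.tsum_comm]
        refine tsum_congr fun i => ?_
        have := hk i
        rw [tsum_eq_single (k i - k₀)]
        · rw [if_pos (by omega)]
        · intro j hj
          rw [if_neg (by omega)]
      have h2 : ∑' j, S (j + k₀) x ≤ ∑' j, q ^ (j + k₀) :=
        ENNReal.tsum_le_tsum fun j => not_lt.1 (hcon (j + k₀))
      exact absurd ((hc x).trans (h1.trans_le h2)) (not_le.2 hq)
    obtain ⟨p, hp, hxp⟩ := Metric.isCover_maximalSeparatedSet (hpack j) hj
    exact ⟨j, p, hp, by simpa [hrc] using hxp⟩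
  -- `E i` has diameter at most `2⁻¹ ^ k i`, so it contains at most one point of the strictly
  -- separated set `P (k i)`.
  · have hone : ∀ i, ∑' p : P (k i), (E i).indicator (fun _ => c i) (p : M) ≤ c i := by
      intro i
      by_cases hex : ∃ p : P (k i), (p : M) ∈ E i
      · obtain ⟨p, hp⟩ := hex
        rw [tsum_eq_single p]
        · exact indicator_le_self' (fun _ _ => zero_le) _
        · intro p' hp'
          refine indicator_of_notMem (fun hmem => ?_) _
          have hsep := Metric.isSeparated_maximalSeparatedSet (ε := r (k i)) (A := A (k i))
            p'.2 p.2 (fun h => hp' (Subtype.ext h))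
          rw [hrc] at hsep
          exact absurd (hE i _ hmem _ hp) (not_le.2 hsep)
      · push Not at hex
        simp [indicator_of_notMem (hex _)]
    calc ∑' j, ∑' _ : P j, (a * q) ^ j
        ≤ ∑' j, ∑' p : P j, a ^ j * S j p := by
          refine ENNReal.tsum_le_tsum fun j => ENNReal.tsum_le_tsum fun p => ?_
          rw [mul_pow]
          exact mul_le_mul_right (le_of_lt (hPA j p.2)) _
      _ = ∑' i, ∑' j, ∑' p : P j,
            a ^ j * (if k i = j then (E i).indicator (fun _ => c i) (p : M) else 0) := by
          rw [ENNReal.tsum_comm]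
          refine tsum_congr fun j => ?_
          rw [ENNReal.tsum_comm]
          refine tsum_congr fun p => ?_
          rw [ENNReal.tsum_mul_left]
      _ ≤ ∑' i, c i * a ^ k i := by
          refine ENNReal.tsum_le_tsum fun i => ?_
          rw [tsum_eq_single (k i)]
          · simp only [if_true]
            rw [ENNReal.tsum_mul_left, mul_comm]
            exact mul_le_mul_left (hone i) _
          · intro j hj
            simp [hj.symm]

/-- Below the Hausdorff dimension, every weighted cover by sufficiently small sets has
total mass at least one. -/
theorem one_le_weighted_sum_of_lt_dimH {M : Type*} [MetricSpace M] [CompactSpace M] {s : ℝ≥0}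
    (hs : (s : ℝ≥0∞) < dimH (univ : Set M)) :
    ∃ k₀ : ℕ, ∀ (E : ℕ → Set M) (c : ℕ → ℝ≥0∞) (k : ℕ → ℕ),
      (∀ i, ∀ x ∈ E i, ∀ y ∈ E i, edist x y ≤ 2⁻¹ ^ k i) → (∀ i, k₀ ≤ k i) →
      (∀ x, 1 ≤ ∑' i, (E i).indicator (fun _ => c i) x) →
      1 ≤ ∑' i, c i * ((2⁻¹ : ℝ≥0∞) ^ (s : ℝ)) ^ k i := by
  obtain ⟨u, hsu, hu⟩ := ENNReal.lt_iff_exists_nnreal_btwn.1 hs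
  have hsu' : (s : ℝ) < u := by exact_mod_cast hsu
  by_contra! hcon
  set a : ℝ≥0∞ := (2⁻¹ : ℝ≥0∞) ^ (s : ℝ) with ha
  -- The spare exponent `u - s` pays for the thresholds.
  set q : ℝ≥0∞ := (2⁻¹ : ℝ≥0∞) ^ ((u : ℝ) - s) with hq
  have haq : a * q = (2⁻¹ : ℝ≥0∞) ^ (u : ℝ) := by
    rw [ha, hq, ← ENNReal.rpow_add _ _ (by simp) (by simp)]
    congr 1
    ring
  have hq1 : q < 1 := ENNReal.rpow_lt_one (by simp) (by linarith)
  have hsum : ∑' j, q ^ j ≠ ∞ := by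
    rw [ENNReal.tsum_geometric]
    exact ENNReal.inv_ne_top.2 (tsub_pos_of_lt hq1).ne'
  have hev : ∀ᶠ n in atTop, ∑' j, q ^ (j + n) < 1 :=
    (ENNReal.tendsto_sum_nat_add (fun j => q ^ j) hsum).eventually_lt_const one_pos
  obtain ⟨N, hN⟩ := eventually_atTop.1 hev
  -- Failure at arbitrarily fine scales yields ball covers with bounded `u`-sums, hence finite
  -- `u`-dimensional Hausdorff measure, although `u < dimH`.
  have hcov : ∀ n : ℕ, ∃ P : ℕ → Set M, (∀ j, (P j).Finite) ∧ (∀ j < n + N, P j = ∅) ∧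
      (∀ x, ∃ j, ∃ p ∈ P j, edist x p ≤ 2⁻¹ ^ j) ∧ ∑' j, ∑' _ : P j, (a * q) ^ j ≤ 1 := by
    intro n
    obtain ⟨E, c, k, h1, h2, h3, h4⟩ := hcon (n + N)
    obtain ⟨P, hP1, hP2, hP3, hP4⟩ := exists_cover_of_weighted_cover a E c k (n + N) h1 h2
      (hN _ (by omega)) h3
    exact ⟨P, hP1, hP2, hP3, hP4.trans h4.le⟩
  choose P hfin hempty hcover hbound using hcov
  have hcount : ∀ n, Countable (Σ j, P n j) := fun n => by
    have : ∀ j, Countable (P n j) := fun j => (hfin n j).countable.to_subtype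
    infer_instance
  set t : ∀ n, (Σ j, P n j) → Set M := fun n p => {y | edist y p.2 ≤ 2⁻¹ ^ p.1} with ht
  have hdiam : ∀ n p, Metric.ediam (t n p) ≤ 2 * 2⁻¹ ^ p.1 := by
    intro n p
    refine Metric.ediam_le fun x hx y hy => ?_
    rw [two_mul]
    exact (edist_triangle_right x y p.2).trans (add_le_add hx hy)
  let _ : MeasurableSpace M := borel M
  have : BorelSpace M := ⟨rfl⟩
  have htop := hausdorffMeasure_of_lt_dimH hu
  have hle := MeasureTheory.Measure.hausdorffMeasure_le_liminf_tsum (u : ℝ) (univ : Set M)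
    (l := atTop) (fun n : ℕ => 2 * (2⁻¹ : ℝ≥0∞) ^ n) (by
      have := ENNReal.Tendsto.const_mul (a := 2)
        (ENNReal.tendsto_pow_atTop_nhds_zero_of_lt_one (r := 2⁻¹) (by simp))
        (Or.inr (by simp))
      simpa using this) t (Eventually.of_forall fun n p => (hdiam n p).trans ?_)
    (Eventually.of_forall fun n x _ => ?_)
  · have hb : ∀ n, ∑' p, Metric.ediam (t n p) ^ (u : ℝ) ≤ 2 ^ (u : ℝ) := by
      intro n
      calc ∑' p, Metric.ediam (t n p) ^ (u : ℝ)
          ≤ ∑' p : (Σ j, P n j), 2 ^ (u : ℝ) * (a * q) ^ p.1 := by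
            refine ENNReal.tsum_le_tsum fun p => ?_
            refine (ENNReal.rpow_le_rpow (hdiam n p) u.coe_nonneg).trans_eq ?_
            rw [ENNReal.mul_rpow_of_nonneg _ _ u.coe_nonneg, haq, pow_rpow_comm]
        _ = 2 ^ (u : ℝ) * ∑' j, ∑' _ : P n j, (a * q) ^ j := by
            rw [ENNReal.tsum_mul_left, ENNReal.tsum_sigma']
        _ ≤ 2 ^ (u : ℝ) := mul_le_of_le_one_right zero_le (hbound n)
    rw [htop] at hle
    have h1 := hle.trans (liminf_le_liminf (Eventually.of_forall hb))
    rw [liminf_const] at h1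
    exact (ENNReal.rpow_lt_top_of_nonneg u.coe_nonneg (by simp)).ne (top_le_iff.1 h1)
  · refine mul_le_mul_right (pow_le_pow_right_of_le_one' (by simp) ?_) _
    by_contra! hlt
    exact (hempty n p.1 (by omega)).le p.2.2
  · obtain ⟨j, p, hp, hxp⟩ := hcover n x
    exact mem_iUnion.2 ⟨⟨j, p, hp⟩, hxp⟩

/-- Lower bounds for weighted covers are multiplicative: here for powers of a space. -/
theorem one_le_weighted_sum_pi {M : Type*} (w : ℕ → ℝ≥0∞) (V : ℕ → Set M → Prop)
    (hM : ∀ (A : ℕ → Set M) (c : ℕ → ℝ≥0∞), (∀ i, V i (A i)) →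
      (∀ x, 1 ≤ ∑' i, (A i).indicator (fun _ => c i) x) → 1 ≤ ∑' i, c i * w i) (n : ℕ)
    (A : ℕ → Fin n → Set M) (c : ℕ → ℝ≥0∞) (hA : ∀ i l, V i (A i l))
    (hc : ∀ y : Fin n → M, 1 ≤ ∑' i, {z : Fin n → M | ∀ l, z l ∈ A i l}.indicator
      (fun _ => c i) y) :
    1 ≤ ∑' i, c i * w i ^ n := by
  classical
  induction n generalizing c with
  | zero => simpa [indicator] using hc Fin.elim0
  | succ n ih =>
    -- Fixing the first coordinate `x` leaves a weighted cover of `M^n` by the boxes whose first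
    -- side contains `x`. Induction shows that the weights `c i * w i ^ n` on the first sides cover
    -- `M`.
    have key : ∀ x, 1 ≤ ∑' i, (A i 0).indicator (fun _ => c i * w i ^ n) x := by
      intro x
      have := ih (fun i l => A i l.succ) (fun i => (A i 0).indicator (fun _ => c i) x)
        (fun i l => hA i _) (fun y => ?_)
      · refine this.trans_eq (tsum_congr fun i => ?_)
        by_cases hx : x ∈ A i 0 <;> simp [hx]
      · refine (hc (Fin.cons x y)).trans_eq (tsum_congr fun i => ?_)
        simp only [indicator, mem_ofPred_eq, Fin.forall_fin_succ, Fin.cons_zero, Fin.cons_succ]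
        split_ifs <;> tauto
    refine (hM (fun i => A i 0) _ (fun i => hA i 0) key).trans_eq (tsum_congr fun i => ?_)
    rw [pow_succ, mul_assoc]

/-! ### Upper bound by covering numbers -/

theorem diam_le {X : Type*} {ρ : X → X → ℝ} {E : Set X} {r : ℝ≥0∞}
    (h : ∀ x ∈ E, ∀ y ∈ E, ENNReal.ofReal (ρ x y) ≤ r) : diam ρ E ≤ r :=
  iSup₂_le fun x hx => iSup₂_le fun y hy => h x hx y hy

theorem le_diam {X : Type*} {ρ : X → X → ℝ} {E : Set X} {x y : X} (hx : x ∈ E) (hy : y ∈ E) :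
    ENNReal.ofReal (ρ x y) ≤ diam ρ E :=
  le_iSup₂_of_le x hx (le_iSup₂_of_le (f := fun y _ => ENNReal.ofReal (ρ x y)) y hy le_rfl)

theorem hausdorffContent_le_card_mul {X ι : Type*} [Fintype ι] (ρ : X → X → ℝ) {r ε : ℝ≥0}
    (s : ℝ≥0) (F : ι → Set X) (hF : ⋃ i, F i = univ) (hd : ∀ i, diam ρ (F i) ≤ r) (hr : r < ε) :
    hausdorffContent ρ ε s ≤ Fintype.card ι * (r : ℝ≥0∞) ^ (s : ℝ) := by
  classical
  -- Integers that encode no index give empty sets, which contribute zero even for `s = 0`.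
  let _ : Encodable ι := Fintype.toEncodable ι
  refine iInf_le_of_le (fun n => ⋃ b ∈ Encodable.decode₂ ι n, F b) (iInf_le_of_le ?_
    (iInf_le_of_le (fun n => ?_) ?_))
  · rw [Encodable.iUnion_decode₂, hF]
  · refine lt_of_le_of_lt (b := (r : ℝ≥0∞)) ?_ (by exact_mod_cast hr)
    refine Encodable.iUnion_decode₂_cases (C := fun S => diam ρ S ≤ r) ?_ hd
    exact diam_le fun x hx => hx.elim
  · rw [tsum_iUnion_decode₂ (m := fun S : Set X => ⨆ _ : S.Nonempty, diam ρ S ^ (s : ℝ)) (by simp)]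
    calc ∑' i, ⨆ _ : (F i).Nonempty, diam ρ (F i) ^ (s : ℝ)
        ≤ ∑' _ : ι, (r : ℝ≥0∞) ^ (s : ℝ) :=
          ENNReal.tsum_le_tsum fun i => iSup_le fun _ => ENNReal.rpow_le_rpow (hd i) s.coe_nonneg
      _ = _ := by simp [tsum_fintype, Finset.sum_const]

theorem pow_mul_rpow_lt_one {N k : ℕ} {R s : ℝ} (hR : 0 < R) (hR1 : R < 1)
    (h : k * Real.log N / |Real.log R| < s) : (N : ℝ) ^ k * R ^ s < 1 := by
  have hlog : Real.log R < 0 := Real.log_neg hR hR1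
  rw [abs_of_neg hlog, div_lt_iff₀ (by linarith)] at h
  have h1 : (N : ℝ) ^ k ≤ Real.exp (k * Real.log N) := by
    rcases Nat.eq_zero_or_pos N with rfl | hN
    · simpa using zero_pow_le_one k
    · rw [mul_comm, Real.exp_mul, Real.exp_log (by exact_mod_cast hN), Real.rpow_natCast]
  have h2 : R ^ s = Real.exp (Real.log R * s) := Real.rpow_def_of_pos hR s
  calc (N : ℝ) ^ k * R ^ s ≤ Real.exp (k * Real.log N) * Real.exp (Real.log R * s) := by
        rw [h2]
        exact mul_le_mul_of_nonneg_right h1 (Real.exp_pos _).le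
    _ = Real.exp (k * Real.log N + Real.log R * s) := (Real.exp_add _ _).symm
    _ < 1 := (Real.exp_lt_exp.2 (by linarith)).trans_eq Real.exp_zero

/-- If finitely many maps into `M` control `ρ`, then `dimScale ρ` is bounded by covering numbers
of `M`. -/
theorem dimScale_le_of_control {X M ι : Type*} [MetricSpace M] [CompactSpace M] [Fintype ι]
    (ρ : X → X → ℝ) (T : ι → X → M) {ε R δ : ℝ≥0} (hε : 0 < ε) (hR : 0 < R) (hR1 : R < 1)
    (hRδ : R < δ) (hT : ∀ x y, (∀ j, dist (T j x) (T j y) ≤ 2 * ε) → ρ x y ≤ R) :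
    dimScale ρ δ ≤ ENNReal.ofReal (Fintype.card ι *
      Real.log ((Metric.coveringNumber ε (univ : Set M)).toNat : ℝ) / |Real.log (R : ℝ)|) := by
  classical
  obtain ⟨S, -, hfin, hcov, hcard⟩ :=
    Metric.exists_set_encard_eq_coveringNumber (coveringNumber_univ_ne_top (M := M) hε)
  have : Fintype S := hfin.fintype
  have hN : (Metric.coveringNumber ε (univ : Set M)).toNat = Fintype.card S := by
    rw [← hcard, Set.encard_eq_coe_toFinset_card, ENat.toNat_natCast, Set.toFinset_card]
  rw [hN]
  refine iSup₂_le fun s hs => ?_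
  by_contra! hlt
  have hlt' := (ENNReal.ofReal_lt_iff_lt_toReal (by positivity) ENNReal.coe_ne_top).1 hlt
  rw [ENNReal.coe_toReal] at hlt'
  have hprod := pow_mul_rpow_lt_one (by exact_mod_cast hR) (by exact_mod_cast hR1) hlt'
  refine absurd hs (not_le.2 ?_)
  -- One set for each choice of a ball centre per control map.
  refine (hausdorffContent_le_card_mul ρ s
    (fun g : ι → S => {x | ∀ j, dist (T j x) (g j) ≤ ε}) ?_ ?_ hRδ).trans_lt ?_
  · refine eq_univ_of_forall fun x => mem_iUnion.2 ?_
    choose g hgS hg using fun j => hcov (mem_univ (T j x))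
    refine ⟨fun j => ⟨g j, hgS j⟩, fun j => ?_⟩
    have := hg j
    simp only [mem_ofPred_eq, edist_nndist] at this
    rw [dist_nndist]
    exact_mod_cast this
  · refine fun g => diam_le fun x hx y hy => ENNReal.ofReal_le_of_le_toReal ?_
    refine hT x y fun j => (dist_triangle_right _ _ (g j : M)).trans ?_
    linarith [hx j, hy j]
  · rw [Fintype.card_fun, ← ENNReal.coe_rpow_of_nonneg _ s.coe_nonneg]
    have : ((Fintype.card S : ℝ≥0) ^ Fintype.card ι * R ^ (s : ℝ) : ℝ≥0) < 1 := by
      rw [← NNReal.coe_lt_coe]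
      push_cast
      exact hprod
    exact_mod_cast this

theorem limsup_div_natCast_le {u : ℕ → ℝ≥0∞} {m : ℕ} {v : ℝ}
    (hu : ∀ n, u n ≤ ENNReal.ofReal ((n + m : ℕ) * v)) :
    limsup (fun n : ℕ => u n / (n : ℝ≥0∞)) atTop ≤ ENNReal.ofReal v := by
  have hlim : Tendsto (fun n : ℕ => ENNReal.ofReal ((1 + m / n) * v)) atTop
      (𝓝 (ENNReal.ofReal v)) := by
    refine ENNReal.tendsto_ofReal ?_
    have h := ((tendsto_const_div_atTop_nhds_zero_nat (m : ℝ)).const_add 1).mul_const v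
    simpa using h
  rw [← hlim.limsup_eq]
  refine limsup_le_limsup ?_
  filter_upwards [eventually_gt_atTop 0] with n hn
  have hn' : (0 : ℝ) < n := by exact_mod_cast hn
  calc u n / (n : ℝ≥0∞) ≤ ENNReal.ofReal ((n + m : ℕ) * v) / ENNReal.ofReal n := by
        rw [ENNReal.ofReal_natCast]
        exact ENNReal.div_le_div_right (hu n) _
    _ = ENNReal.ofReal ((1 + m / n) * v) := by
        rw [← ENNReal.ofReal_div_of_pos hn']
        congr 1
        push_cast
        field_simp

theorem tendsto_neg_log_coe_nhdsGT_zero :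
    Tendsto (fun ε : ℝ≥0 => -Real.log (ε : ℝ)) (𝓝[>] 0) atTop := by
  refine tendsto_neg_atBot_atTop.comp (Real.tendsto_log_nhdsGT_zero.comp ?_)
  refine tendsto_nhdsWithin_iff.2 ⟨?_, ?_⟩
  · exact (NNReal.continuous_coe.tendsto' 0 0 rfl).mono_left nhdsWithin_le_nhds
  · filter_upwards [self_mem_nhdsWithin] with ε hε
    exact_mod_cast hε

theorem upperMdimH_le_lowerBoxDim {X M : Type*} [MetricSpace M] [CompactSpace M]
    (ρ : X → X → ℝ) (f : X → X) {C : ℝ≥0} (hC : 0 < C)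
    (H : ∀ ε : ℝ≥0, 0 < ε → ∃ m : ℕ, ∀ n : ℕ, ∃ T : Fin (n + m) → X → M, ∀ x y,
      (∀ j, dist (T j x) (T j y) ≤ 2 * ε) → dynDist ρ f n x y ≤ C * ε) :
    upperMdimH ρ f ≤ lowerBoxDim M := by
  refine le_of_tendsto (tendsto_upperRate ρ f) ?_
  filter_upwards [self_mem_nhdsWithin] with δ hδ
  -- The factor `θ < 1` absorbs `C`: for small `ε`, `θ * |log ε| ≤ |log (C * ε)|`.
  refine ENNReal.le_of_forall_lt_one_mul_le fun θ hθ => ?_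
  lift θ to ℝ≥0 using hθ.ne_top
  have hθ1 : (θ : ℝ) < 1 := by exact_mod_cast hθ
  refine le_liminf_of_le (by isBoundedDefault) ?_
  have hsmall : ∀ᶠ ε : ℝ≥0 in 𝓝[>] 0, C * ε < min δ 1 := by
    have : Tendsto (fun ε : ℝ≥0 => C * ε) (𝓝[>] 0) (𝓝 0) :=
      ((continuous_const_mul C).tendsto' 0 0 (mul_zero C)).mono_left nhdsWithin_le_nhds
    exact this.eventually_lt_const (lt_min hδ one_pos)
  filter_upwards [hsmall, self_mem_nhdsWithin,
    tendsto_neg_log_coe_nhdsGT_zero.eventually_ge_atTop (Real.log C / (1 - θ)),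
    tendsto_neg_log_coe_nhdsGT_zero.eventually_gt_atTop 0] with ε hε hε0 hlog hlog0
  have hε0 : 0 < ε := hε0
  have hR : 0 < C * ε := mul_pos hC hε0
  have hR1 : C * ε < 1 := hε.trans_le (min_le_right _ _)
  obtain ⟨m, hm⟩ := H ε hε0
  set L := Real.log ((Metric.coveringNumber ε (univ : Set M)).toNat : ℝ)
  have hL : 0 ≤ L := Real.log_natCast_nonneg _
  have hrate : upperRate ρ f δ ≤ ENNReal.ofReal (L / |Real.log ((C * ε : ℝ≥0) : ℝ)|) := by
    refine limsup_div_natCast_le (m := m) fun n => ?_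
    obtain ⟨T, hT⟩ := hm n
    have := dimScale_le_of_control (dynDist ρ f n) T hε0 hR hR1
      (hε.trans_le (min_le_left _ _)) (by simpa using hT)
    rwa [Fintype.card_fin, mul_div_assoc] at this
  refine (mul_le_mul_right hrate _).trans ?_
  rw [← ENNReal.ofReal_coe_nnreal, ← ENNReal.ofReal_mul θ.coe_nonneg]
  refine ENNReal.ofReal_le_ofReal ?_
  have hneg : Real.log ((C * ε : ℝ≥0) : ℝ) < 0 :=
    Real.log_neg (by exact_mod_cast hR) (by exact_mod_cast hR1)
  have hadd : Real.log ((C * ε : ℝ≥0) : ℝ) = Real.log C + Real.log ε := by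
    rw [NNReal.coe_mul, Real.log_mul] <;> positivity
  rw [abs_of_neg hneg, abs_of_neg (by linarith : Real.log (ε : ℝ) < 0), ← mul_div_assoc,
    div_le_div_iff₀ (by linarith) hlog0, hadd]
  rw [div_le_iff₀ (by linarith)] at hlog
  nlinarith [mul_nonneg hL (sub_nonneg.2 hlog)]

/-! ### Lower bound by Hausdorff dimension -/

/-- Rounding a diameter to a dyadic scale loses a constant factor, absorbed by lowering `s` to `s'`.
Both exponents scale with `n`, so `ε` need not depend on `n`. -/
theorem exists_dyadic_scale {s s' : ℝ≥0} (h : s' < s) (k₀ : ℕ) :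
    ∃ ε : ℝ≥0, 0 < ε ∧ ∀ (n : ℕ) (D η : ℝ≥0∞), 0 < n → D < ε → 0 < η →
      ∃ k, k₀ ≤ k ∧ 2 * D ≤ 2⁻¹ ^ k ∧
        (((2⁻¹ : ℝ≥0∞) ^ (s : ℝ)) ^ k) ^ n ≤ D ^ ((n : ℝ) * s') + η := by
  classical
  have h' : (s' : ℝ) < s := by exact_mod_cast h
  have hs0 : (0 : ℝ) < s := s'.coe_nonneg.trans_lt h'
  -- For `k ≥ k₁` one has `(k + 2) * s' ≤ k * s`.
  set k₁ := max k₀ ⌈2 * (s' : ℝ) / (s - s')⌉₊ with hk₁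
  have hpow : Tendsto (fun k : ℕ => (2⁻¹ : ℝ≥0∞) ^ k) atTop (𝓝 0) :=
    ENNReal.tendsto_pow_atTop_nhds_zero_of_lt_one (by simp)
  refine ⟨2⁻¹ ^ (k₁ + 1), by positivity, fun n D η hn hD hη => ?_⟩
  have hD2 : 2 * D ≤ 2⁻¹ ^ k₁ := by
    have h1 : (((2⁻¹ : ℝ≥0) ^ (k₁ + 1) : ℝ≥0) : ℝ≥0∞) = 2⁻¹ ^ (k₁ + 1) := by
      simp [ENNReal.coe_inv, ENNReal.inv_pow]
    rw [h1] at hD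
    calc 2 * D ≤ 2 * 2⁻¹ ^ (k₁ + 1) := mul_le_mul_right hD.le _
      _ = 2⁻¹ ^ k₁ := by
        rw [pow_succ', ← mul_assoc, ENNReal.mul_inv_cancel (by simp) (by simp), one_mul]
  -- A set of diameter zero has no finest dyadic scale; a large `k` brings its cost below `η`.
  rcases eq_or_ne D 0 with rfl | hD0
  · have ha : (2⁻¹ : ℝ≥0∞) ^ (s : ℝ) < 1 := ENNReal.rpow_lt_one (by simp) hs0
    obtain ⟨k, hk, hkη⟩ := ((eventually_ge_atTop k₀).and
      ((ENNReal.tendsto_pow_atTop_nhds_zero_of_lt_one ha).eventually_lt_const hη)).exists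
    refine ⟨k, hk, by simp, ?_⟩
    exact (((pow_le_pow_right_of_le_one' (pow_le_one' ha.le k) hn).trans_eq (pow_one _)).trans
      hkη.le).trans le_add_self
  · have hex : ∃ m : ℕ, (2⁻¹ : ℝ≥0∞) ^ m < 2 * D :=
      (hpow.eventually_lt_const (by positivity)).exists
    obtain ⟨m, hm, hmin⟩ : ∃ m : ℕ, (2⁻¹ : ℝ≥0∞) ^ m < 2 * D ∧ ∀ j < m, 2 * D ≤ 2⁻¹ ^ j :=
      ⟨Nat.find hex, Nat.find_spec hex, fun j hj => not_lt.1 (Nat.find_min hex hj)⟩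
    have hk₁m : k₁ < m := by
      by_contra! hle
      exact absurd (hD2.trans (pow_le_pow_right_of_le_one' (by simp) hle)) (not_le.2 hm)
    obtain ⟨k, rfl⟩ : ∃ k, m = k + 1 := ⟨m - 1, by omega⟩
    have hkk : k₁ ≤ k := by omega
    refine ⟨k, (le_max_left _ _).trans hkk, hmin k (by omega), le_add_right ?_⟩
    have hDk : (2⁻¹ : ℝ≥0∞) ^ (k + 2) ≤ D := by
      have := mul_le_mul_right hm.le (2⁻¹ : ℝ≥0∞)
      rwa [← mul_assoc, ENNReal.inv_mul_cancel (by simp) (by simp), one_mul, ← pow_succ'] at this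
    refine le_trans ?_ (ENNReal.rpow_le_rpow hDk (by positivity))
    rw [← ENNReal.rpow_natCast, ← ENNReal.rpow_natCast, ← ENNReal.rpow_natCast,
      ← ENNReal.rpow_mul, ← ENNReal.rpow_mul, ← ENNReal.rpow_mul]
    refine ENNReal.rpow_le_rpow_of_exponent_ge (by simp) ?_
    have hk2 : 2 * (s' : ℝ) / (s - s') ≤ k :=
      (Nat.le_ceil _).trans (by exact_mod_cast (le_max_right _ _).trans hkk)
    rw [div_le_iff₀ (by linarith)] at hk2
    have hn0 : (0 : ℝ) ≤ n := n.cast_nonneg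
    push_cast
    nlinarith

theorem one_le_hausdorffContent {X M : Type*} [MetricSpace M] [CompactSpace M] {s s' : ℝ≥0}
    (hs : (s : ℝ≥0∞) < dimH (univ : Set M)) (hs' : s' < s) (hs0 : 0 < s') :
    ∃ ε : ℝ≥0, 0 < ε ∧ ∀ (n : ℕ) (ρ : X → X → ℝ) (t : Fin n → X → M), 0 < n →
      (∀ y : Fin n → M, ∃ x, ∀ l, t l x = y l) →
      (∀ l x y, dist (t l x) (t l y) ≤ 2 * ρ x y) →
      1 ≤ hausdorffContent ρ ε (n * s') := by
  classical
  obtain ⟨k₀, hk₀⟩ := one_le_weighted_sum_of_lt_dimH hs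
  obtain ⟨ε, hε, hscale⟩ := exists_dyadic_scale hs' k₀
  refine ⟨ε, hε, fun n ρ t hn hsurj hdist => ?_⟩
  refine le_iInf fun E => le_iInf fun hE => le_iInf fun hd => ?_
  refine ENNReal.le_of_forall_pos_le_add fun η hη _ => ?_
  -- The errors allowed for the individual sets have total below `η`.
  obtain ⟨η', hη', hsum⟩ := ENNReal.exists_pos_sum_of_countable'
    (ENNReal.coe_ne_zero.2 hη.ne') ℕ
  choose k hk hkD hkn using fun i => hscale n (diam ρ (E i)) (η' i) hn (hd i) (hη' i)
  have key := one_le_weighted_sum_pi (fun i => ((2⁻¹ : ℝ≥0∞) ^ (s : ℝ)) ^ k i)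
    (fun i S => ∀ x ∈ S, ∀ y ∈ S, edist x y ≤ 2⁻¹ ^ k i)
    (fun A c hA hc => hk₀ A c k hA hk hc) n (fun i l => t l '' E i) (fun _ => 1) ?_ ?_
  · calc 1 ≤ _ := key
      _ ≤ ∑' i, ((⨆ _ : (E i).Nonempty, diam ρ (E i) ^ ((n * s' : ℝ≥0) : ℝ)) + η' i) := by
        refine ENNReal.tsum_le_tsum fun i => ?_
        rw [one_mul]
        refine (hkn i).trans (add_le_add_left ?_ _)
        rw [NNReal.coe_mul, NNReal.coe_natCast]
        -- Empty sets are harmless because the exponent is positive.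
        rcases (E i).eq_empty_or_nonempty with hemp | hne
        · have : diam ρ (E i) = 0 := by simp [hemp, diam]
          rw [this, ENNReal.zero_rpow_of_pos (by positivity)]
          exact zero_le
        · exact le_iSup_of_le hne le_rfl
      _ ≤ _ := by
        rw [ENNReal.tsum_add]
        exact add_le_add_right hsum.le _
  · rintro i l _ ⟨x, hx, rfl⟩ _ ⟨y, hy, rfl⟩
    refine le_trans ?_ (hkD i)
    calc edist (t l x) (t l y) ≤ ENNReal.ofReal (2 * ρ x y) := by
          rw [edist_dist]
          exact ENNReal.ofReal_le_ofReal (hdist l x y)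
      _ = 2 * ENNReal.ofReal (ρ x y) := by
          rw [ENNReal.ofReal_mul (by norm_num), ENNReal.ofReal_ofNat]
      _ ≤ 2 * diam ρ (E i) := mul_le_mul_right (le_diam hx hy) _
  · intro y
    obtain ⟨x, hx⟩ := hsurj y
    obtain ⟨i, hi⟩ := mem_iUnion.1 (hE.ge (mem_univ x))
    refine le_trans ?_ (ENNReal.le_tsum i)
    rw [indicator_of_mem]
    exact fun l => ⟨x, hi, hx l⟩

theorem dimH_le_lowerMdimH {X M : Type*} [MetricSpace M] [CompactSpace M] (ρ : X → X → ℝ)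
    (f : X → X) (t : ℕ → X → M) (hsurj : ∀ n > 0, ∀ y : Fin n → M, ∃ x, ∀ l : Fin n, t l x = y l)
    (hdist : ∀ n, ∀ l < n, ∀ x y, dist (t l x) (t l y) ≤ 2 * dynDist ρ f n x y) :
    dimH (univ : Set M) ≤ lowerMdimH ρ f := by
  refine ENNReal.le_of_forall_nnreal_lt fun s' hs' => ?_
  rcases eq_or_ne s' 0 with rfl | h0
  · simp
  obtain ⟨s, hs1, hs2⟩ := ENNReal.lt_iff_exists_nnreal_btwn.1 hs'
  obtain ⟨ε, hε, hcont⟩ := one_le_hausdorffContent (X := X) hs2 (by exact_mod_cast hs1)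
    (pos_iff_ne_zero.2 h0)
  have hrate : (s' : ℝ≥0∞) ≤ lowerRate ρ f ε := by
    refine le_liminf_of_le (by isBoundedDefault) ?_
    filter_upwards [eventually_gt_atTop 0] with n hn
    rw [ENNReal.le_div_iff_mul_le (by simp [hn.ne']) (by simp), mul_comm]
    refine le_iSup₂_of_le (n * s' : ℝ≥0) (hcont n (dynDist ρ f n) (fun l => t l) hn (hsurj n hn)
      fun l => hdist n l l.2) ?_
    simp
  refine ge_of_tendsto (tendsto_lowerRate ρ f) ?_
  filter_upwards [Ioo_mem_nhdsGT hε] with δ hδ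
  exact hrate.trans (lowerRate_antitone ρ f hδ.2.le)

/-! ### Dynamical distances and general maps -/

theorem lowerMdimH_le_upperMdimH {X : Type*} (ρ : X → X → ℝ) (f : X → X) :
    lowerMdimH ρ f ≤ upperMdimH ρ f :=
  le_of_tendsto_of_tendsto' (tendsto_lowerRate ρ f) (tendsto_upperRate ρ f) fun _ =>
    liminf_le_limsup

theorem le_dynDist {X : Type*} (ρ : X → X → ℝ) (f : X → X) {n l : ℕ} (hl : l < n) (x y : X) :
    ρ (f^[l] x) (f^[l] y) ≤ dynDist ρ f n x y :=
  le_ciSup (f := fun k : Fin n => ρ (f^[k] x) (f^[k] y)) (Set.finite_range _).bddAbove ⟨l, hl⟩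

theorem dynDist_le {X : Type*} {ρ : X → X → ℝ} {f : X → X} {n : ℕ} {x y : X} {r : ℝ}
    (hr : 0 ≤ r) (h : ∀ l < n, ρ (f^[l] x) (f^[l] y) ≤ r) : dynDist ρ f n x y ≤ r :=
  -- Nonnegativity of `r` handles `n = 0`, where the supremum is zero.
  Real.iSup_le (fun k => h k k.2) hr

/-- The first `n` iterates of `f` are themselves the control maps. -/
theorem upperMdimH_dist_le_lowerBoxDim {M : Type*} [MetricSpace M] [CompactSpace M] (f : M → M) :
    upperMdimH (fun x y : M => dist x y) f ≤ lowerBoxDim M := by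
  refine upperMdimH_le_lowerBoxDim _ f (C := 2) (by norm_num) fun ε _ =>
    ⟨0, fun n => ⟨fun i => f^[i], fun x y h => dynDist_le (by positivity) fun l hl => ?_⟩⟩
  simpa using h ⟨l, by omega⟩

theorem shift_iterate {K M : Type*} [Add K] [One K] (k : ℕ) (x : K → M) (j : K) :
    shift^[k] x j = x ((· + 1)^[k] j) := by
  induction k generalizing x with
  | zero => rfl
  | succ k ih =>
    rw [Function.iterate_succ_apply, ih, Function.iterate_succ_apply', shift]

/-! ### Shifts on product spaces -/

section ProdDist

variable {K M : Type*} [MetricSpace M] [CompactSpace M] {absIdx : K → ℕ}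

theorem dist_le_prodDist (hw : Summable fun j => (1 : ℝ) / 2 ^ absIdx j) (x y : K → M) (j : K) :
    1 / 2 ^ absIdx j * dist (x j) (y j) ≤ prodDist absIdx x y :=
  (summable_of_weights absIdx hw x y).le_tsum j fun i _ => by positivity

/-- Coordinates in `F` contribute at most `2 * ε` times the total weight; the tail contributes at
most `ε`. -/
theorem prodDist_le_of_close (hw : Summable fun j => (1 : ℝ) / 2 ^ absIdx j) {ε : ℝ}
    {F : Finset K} (hF : ∑' j : {j // j ∉ F}, 1 / 2 ^ absIdx j * Metric.diam (univ : Set M) ≤ ε)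
    {x y : K → M} (h : ∀ j ∈ F, dist (x j) (y j) ≤ 2 * ε) :
    prodDist absIdx x y ≤ (2 * ∑' j, (1 : ℝ) / 2 ^ absIdx j + 1) * ε := by
  set D := Metric.diam (univ : Set M)
  set w : K → ℝ := fun j => 1 / 2 ^ absIdx j with hwdef
  have hε : 0 ≤ ε := (tsum_nonneg fun j => by positivity).trans hF
  have hw0 : ∀ j, 0 ≤ w j := fun j => by positivity
  have hs1 : Summable fun j => w j * (2 * ε) := hw.mul_right _
  have hs2 : Summable ({j | j ∉ F}.indicator fun j => w j * D) := (hw.mul_right D).indicator _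
  calc prodDist absIdx x y
      ≤ ∑' j, (w j * (2 * ε) + {j | j ∉ F}.indicator (fun j => w j * D) j) := by
        refine (summable_of_weights absIdx hw x y).tsum_le_tsum (fun j => ?_) (hs1.add hs2)
        by_cases hj : j ∈ F
        · rw [indicator_of_notMem (by simpa using hj), add_zero]
          exact mul_le_mul_of_nonneg_left (h j hj) (hw0 j)
        · have hd : dist (x j) (y j) ≤ D :=
            Metric.dist_le_diam_of_mem isCompact_univ.isBounded (mem_univ _) (mem_univ _)
          rw [indicator_of_mem (by exact hj)]
          have := mul_le_mul_of_nonneg_left hd (hw0 j)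
          have := mul_nonneg (hw0 j) (by positivity : 0 ≤ 2 * ε)
          linarith
    _ = (∑' j, w j) * (2 * ε) + ∑' j : {j // j ∉ F}, w j * D := by
        rw [hs1.tsum_add hs2, tsum_mul_right]
        congr 1
        exact (tsum_subtype {j | j ∉ F} fun j => w j * D).symm
    _ ≤ (2 * ∑' j, w j + 1) * ε := by linarith

variable [Add K] [One K]

/-- A finite window `F` carries the product distance up to `O(ε)`. By `hwin`, its first `n`
translates fit into `n + m` indices. -/
theorem upperMdimH_prodDist_le_lowerBoxDim (hw : Summable fun j => (1 : ℝ) / 2 ^ absIdx j)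
    (hwin : ∀ F : Finset K, ∃ m : ℕ, ∀ n : ℕ, ∃ e : Fin (n + m) → K,
      ∀ j ∈ F, ∀ k < n, ∃ i, e i = (· + 1)^[k] j) :
    upperMdimH (prodDist (M := M) absIdx) shift ≤ lowerBoxDim M := by
  have hW : 0 ≤ ∑' j, (1 : ℝ) / 2 ^ absIdx j := tsum_nonneg fun j => by positivity
  obtain ⟨C, hC⟩ : ∃ C : ℝ≥0, (C : ℝ) = 2 * ∑' j, (1 : ℝ) / 2 ^ absIdx j + 1 :=
    ⟨⟨_, by positivity⟩, rfl⟩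
  have hC0 : 0 < C := by
    rw [← NNReal.coe_pos, hC]
    positivity
  refine upperMdimH_le_lowerBoxDim _ _ hC0 fun ε hε => ?_
  have hε' : (0 : ℝ) < ε := by exact_mod_cast hε
  obtain ⟨F, hF⟩ := ((tendsto_tsum_compl_atTop_zero fun j : K =>
    (1 : ℝ) / 2 ^ absIdx j * Metric.diam (univ : Set M)).eventually_lt_const hε').exists
  obtain ⟨m, hm⟩ := hwin F
  refine ⟨m, fun n => ?_⟩
  obtain ⟨e, he⟩ := hm n
  refine ⟨fun i x => x (e i), fun x y h => ?_⟩
  refine dynDist_le (by positivity) fun l hl => ?_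
  rw [hC]
  refine prodDist_le_of_close hw hF.le fun j hj => ?_
  obtain ⟨i, hi⟩ := he j hj l hl
  rw [shift_iterate, shift_iterate, ← hi]
  exact h i

/-- The coordinates met by `j₀` under translation are distinct, so they can be prescribed freely;
the weight at `j₀` is at least `1 / 2`, whence the factor two. -/
theorem dimH_le_lowerMdimH_prodDist (hw : Summable fun j => (1 : ℝ) / 2 ^ absIdx j) (j₀ : K)
    (hj₀ : absIdx j₀ ≤ 1) (hinj : Function.Injective fun k : ℕ => (· + 1)^[k] j₀) :
    dimH (univ : Set M) ≤ lowerMdimH (prodDist (M := M) absIdx) shift := by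
  refine dimH_le_lowerMdimH _ _ (fun l x => x ((· + 1)^[l] j₀)) (fun n hn y => ?_)
    fun n l hl x y => ?_
  · have hinj' : Function.Injective fun l : Fin n => (· + 1)^[(l : ℕ)] j₀ :=
      hinj.comp Fin.val_injective
    exact ⟨Function.extend _ y fun _ => y ⟨0, hn⟩, fun l => hinj'.extend_apply y _ l⟩
  · have h1 := le_dynDist (prodDist (M := M) absIdx) shift hl x y
    have h2 := dist_le_prodDist hw (shift^[l] x) (shift^[l] y) j₀
    rw [shift_iterate, shift_iterate] at h2
    have h3 : (1 : ℝ) / 2 ≤ 1 / 2 ^ absIdx j₀ :=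
      one_div_le_one_div_of_le (by positivity)
        ((pow_le_pow_right₀ one_le_two hj₀).trans_eq (pow_one 2))
    have h4 := mul_le_mul_of_nonneg_right h3
      (dist_nonneg (x := x ((· + 1)^[l] j₀)) (y := y ((· + 1)^[l] j₀)))
    linarith

theorem mdimH_prodDist_eq_dimH (h : dimH (univ : Set M) = lowerBoxDim M)
    (hw : Summable fun j => (1 : ℝ) / 2 ^ absIdx j) (j₀ : K) (hj₀ : absIdx j₀ ≤ 1)
    (hinj : Function.Injective fun k : ℕ => (· + 1)^[k] j₀)
    (hwin : ∀ F : Finset K, ∃ m : ℕ, ∀ n : ℕ, ∃ e : Fin (n + m) → K,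
      ∀ j ∈ F, ∀ k < n, ∃ i, e i = (· + 1)^[k] j) :
    lowerMdimH (prodDist (M := M) absIdx) shift = dimH (univ : Set M) ∧
      upperMdimH (prodDist (M := M) absIdx) shift = dimH (univ : Set M) := by
  have h1 := dimH_le_lowerMdimH_prodDist (M := M) hw j₀ hj₀ hinj
  have h2 := lowerMdimH_le_upperMdimH (prodDist (M := M) absIdx) shift
  have h3 := (upperMdimH_prodDist_le_lowerBoxDim (M := M) hw hwin).trans_eq h.symm
  exact ⟨le_antisymm (h2.trans h3) h1, le_antisymm h3 (h1.trans h2)⟩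

end ProdDist

/-! ### The index sets and the conclusion -/

theorem summable_one_div_two_pow : Summable fun j : ℕ => (1 : ℝ) / 2 ^ j := by
  simpa using summable_geometric_two

theorem coe_iterate_add_one_pnat (k : ℕ) (j : ℕ+) : (((· + 1)^[k] j : ℕ+) : ℕ) = j + k := by
  induction k with
  | zero => rfl
  | succ k ih => rw [Function.iterate_succ_apply', PNat.add_coe, ih, PNat.one_coe, add_assoc]

theorem iterate_add_one_int (k : ℕ) (j : ℤ) : (· + 1)^[k] j = j + k := by
  induction k with
  | zero => simp
  | succ k ih =>
    rw [Function.iterate_succ_apply', ih]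
    push_cast
    ring

end MeanHausdorff

theorem mainTheorem5 {M : Type*} [MetricSpace M] [CompactSpace M]
    (h : dimH (univ : Set M) = MeanHausdorff.lowerBoxDim M) :
    (MeanHausdorff.lowerMdimH (MeanHausdorff.prodDistNat (M := M)) MeanHausdorff.shift
          = dimH (univ : Set M) ∧
      MeanHausdorff.upperMdimH (MeanHausdorff.prodDistNat (M := M)) MeanHausdorff.shift
          = dimH (univ : Set M)) ∧
    (MeanHausdorff.lowerMdimH (MeanHausdorff.prodDistInt (M := M)) MeanHausdorff.shift
          = dimH (univ : Set M) ∧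
      MeanHausdorff.upperMdimH (MeanHausdorff.prodDistInt (M := M)) MeanHausdorff.shift
          = dimH (univ : Set M)) ∧
    ∀ f : M → M, Continuous f →
      MeanHausdorff.lowerMdimH (fun x y : M => dist x y) f
          ≤ MeanHausdorff.upperMdimH (fun x y : M => dist x y) f ∧
      MeanHausdorff.upperMdimH (fun x y : M => dist x y) f ≤ dimH (univ : Set M) := by
  refine ⟨?_, ?_, fun f _ => ⟨MeanHausdorff.lowerMdimH_le_upperMdimH _ f,
    (MeanHausdorff.upperMdimH_dist_le_lowerBoxDim f).trans_eq h.symm⟩⟩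
  · refine MeanHausdorff.mdimH_prodDist_eq_dimH (absIdx := fun j : ℕ+ => (j : ℕ)) h
      (MeanHausdorff.summable_one_div_two_pow.comp_injective PNat.coe_injective) 1 le_rfl
      -- If `F` lies in `[1, B]`, its translates by `k < n` lie in `[1, n + B]`.
      (fun k l hkl => ?_) fun F => ⟨F.sup (fun j => (j : ℕ)), fun n =>
        ⟨fun i => Nat.succPNat i, fun j hj k hk => ?_⟩⟩
    · have := congrArg PNat.val hkl
      simp only [PNat.val_ofNat, MeanHausdorff.coe_iterate_add_one_pnat] at this
      omega
    · have hjF : (j : ℕ) ≤ F.sup (fun j => (j : ℕ)) := Finset.le_sup (f := fun j : ℕ+ => (j : ℕ)) hj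
      have hj0 := j.pos
      refine ⟨⟨j + k - 1, by omega⟩, PNat.eq ?_⟩
      rw [MeanHausdorff.coe_iterate_add_one_pnat, Nat.succPNat_coe]
      simp only [Nat.succ_eq_add_one]
      omega
  · refine MeanHausdorff.mdimH_prodDist_eq_dimH (absIdx := Int.natAbs) h
      (Summable.of_nat_of_neg (by simpa using MeanHausdorff.summable_one_div_two_pow)
        (by simpa using MeanHausdorff.summable_one_div_two_pow)) 0 (by simp)
      -- If `F` lies in `[-B, B]`, its translates by `k < n` lie in `[-B, n + B]`, which has `n + 2
      -- * B + 1` elements.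
      (fun k l hkl => ?_) fun F => ⟨2 * F.sup Int.natAbs + 1, fun n =>
        ⟨fun i => (i : ℤ) - F.sup Int.natAbs, fun j hj k hk => ?_⟩⟩
    · simpa [MeanHausdorff.iterate_add_one_int] using hkl
    · have hjF : j.natAbs ≤ F.sup Int.natAbs := Finset.le_sup hj
      refine ⟨⟨(j + k + F.sup Int.natAbs).toNat, by omega⟩, ?_⟩
      rw [MeanHausdorff.iterate_add_one_int]
      simp only
      omega
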